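/- For integers $1\le k\le d-1$, a $k$-flat in $\mathbb{R}^d$ is the affine hull of $k+1$ affinely independent points, a convex body is a compact convex set, and for $\varepsilon\in(0,1)$ a $(k,\varepsilon)$-net for $[0,1]^d$ is a set $\mathcal{K}$ of $k$-flats in $\mathbb{R}^d$ such that every convex body $\Xi\subseteq\mathbb{R}^d$ with $\mathrm{vol}(\Xi\cap[0,1]^d)\ge\varepsilon$ meets some flat of $\mathcal{K}$. Fix $k\ge 1$. For real $\varepsilon>0$ and integers $D\ge k+1$ define sets $\mathcal{K}_D(\varepsilon)$ of $k$-flats in $\mathbb{R}^D$ by recursion on $D$ as follows. (i) $\mathcal{K}_{k+1}(\varepsilon)$ consists of the hyperplanes $\{x_j=m\,\varepsilon^{1/(k+1)}\}$ with $1\le j\le k+1$ and $m\ge 1$ an integer with $m\,\varepsilon^{1/(k+1)}\le 1$. (ii) For $D\ge k+2$ let $\tau=\lceil \frac1D\log_2\frac1\varepsilon\rceil+3\lceil\log_2(3D)\rceil+1$ and $\varepsilon_i=2^i\varepsilon/(4D)$. For every axis $1\le j\le D$, every level $1\le i\le\tau$ and every odd integer $m$ with $0<m<2^i$, take the splitting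 hyperplane $h=\{x_j=m/2^i\}$ (which halves quadtree cells of side $2^{-(i-1)}$), identify it with $\mathbb{R}^{D-1}$ by deleting the $j$-th coordinate, and place on it a copy of $\mathcal{K}_{D-1}(\varepsilon_i)$. Then $\mathcal{K}_D(\varepsilon)$ is the collection of all $k$-flats so obtained. Theorem. For every $d$ there is a constant $C_d>0$, depending only on $d$, such that for all integers $1\le k\le d-1$ and all $\varepsilon\in(0,1)$ the explicit, deterministic set $\mathcal{K}_d(\varepsilon)$ (which depends only on $d,k,\varepsilon$) is a finite $(k,\varepsilon)$-net for $[0,1]^d$ with $$|\mathcal{K}_d(\varepsilon)|\le \frac{C_d}{\varepsilon^{1-k/d}}.$$ -/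

import Mathlib

open MeasureTheory

noncomputable section

/-- The unit cube `[0,1]^d` in Euclidean space. -/
def unitCube (d : ℕ) : Set (EuclideanSpace ℝ (Fin d)) :=
  {x | ∀ j, x j ∈ Set.Icc (0 : ℝ) 1}

/-- A `k`-flat: the affine hull of `k + 1` affinely independent points. -/
def IsFlat {d : ℕ} (k : ℕ) (F : AffineSubspace ℝ (EuclideanSpace ℝ (Fin d))) : Prop :=
  ∃ p : Fin (k + 1) → EuclideanSpace ℝ (Fin d),
    AffineIndependent ℝ p ∧ F = affineSpan ℝ (Set.range p)

/-- A `(k, ε)`-net: a set of `k`-flats such that every convex body (compact and convex) whose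
intersection with the unit cube has volume at least `ε` meets one of the flats. -/
def IsKEpsNet {d : ℕ} (k : ℕ) (ε : ℝ)
    (S : Set (AffineSubspace ℝ (EuclideanSpace ℝ (Fin d)))) : Prop :=
  (∀ F ∈ S, IsFlat k F) ∧
    ∀ K : ConvexBody (EuclideanSpace ℝ (Fin d)),
      ENNReal.ofReal ε ≤ volume ((K : Set (EuclideanSpace ℝ (Fin d))) ∩ unitCube d) →
        ∃ F ∈ S, ((F : Set (EuclideanSpace ℝ (Fin d))) ∩ K).Nonempty

/-- The hyperplane `{x | x j = c}`, orthogonal to the `j`-th axis. -/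
def axisHyperplane {d : ℕ} (j : Fin d) (c : ℝ) :
    AffineSubspace ℝ (EuclideanSpace ℝ (Fin d)) where
  carrier := {x | x j = c}
  smul_vsub_vadd_mem' := by
    intro t p₁ p₂ p₃ h₁ h₂ h₃
    simp only [Set.mem_ofPred_eq] at h₁ h₂ h₃ ⊢
    simp [h₁, h₂, h₃]

/-- The standard identification of `ℝ^d` with the hyperplane `{x | x j = c}` of `ℝ^(d+1)`:
insert the value `c` as the `j`-th coordinate. -/
def hyperplaneEmbedding {d : ℕ} (j : Fin (d + 1)) (c : ℝ) :
    EuclideanSpace ℝ (Fin d) →ᵃ[ℝ] EuclideanSpace ℝ (Fin (d + 1)) where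
  toFun x := WithLp.toLp 2 (j.insertNth (α := fun _ => ℝ) c fun i => x i)
  linear :=
    { toFun := fun x => WithLp.toLp 2 (j.insertNth (α := fun _ => ℝ) 0 fun i => x i)
      map_add' := by
        intro x y
        ext i
        refine Fin.succAboveCases j ?_ (fun i => ?_) i <;> simp
      map_smul' := by
        intro t x
        ext i
        refine Fin.succAboveCases j ?_ (fun i => ?_) i <;> simp }
  map_vadd' := by
    intro p v
    ext i
    refine Fin.succAboveCases j ?_ (fun i => ?_) i <;> simp

/-- The hyperplanes of the grid of side length `ε^(1/d)` on `[0,1]^d`, i.e. the hyperplanes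
`{x | x j = m ε^(1/d)}` for all axes `j` and all integers `m ≥ 1` with `m ε^(1/d) ≤ 1`. -/
def gridHyperplanes (d : ℕ) (ε : ℝ) : Set (AffineSubspace ℝ (EuclideanSpace ℝ (Fin d))) :=
  {F | ∃ (j : Fin d) (m : ℕ), 1 ≤ m ∧ (m : ℝ) * ε ^ (1 / (d : ℝ)) ≤ 1 ∧
    F = axisHyperplane j ((m : ℝ) * ε ^ (1 / (d : ℝ)))}

/-- The depth `τ` of the quadtree in dimension `d`. -/
def quadtreeDepth (d : ℕ) (ε : ℝ) : ℤ :=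
  ⌈1 / (d : ℝ) * Real.logb 2 (1 / ε)⌉ + 3 * ⌈Real.logb 2 (3 * (d : ℝ))⌉ + 1

/-- The parameter `ε_i` of the nets on the splitting hyperplanes of level `i` in dimension `d`. -/
def levelEps (d : ℕ) (ε : ℝ) (i : ℕ) : ℝ :=
  2 ^ i * ε / (4 * (d : ℝ))

/-- The quadtree construction, by recursion on the dimension.
In dimension `k + 1` it consists of the grid hyperplanes.
In a dimension `D ≥ k + 2`, the cells of side length `2^(-(i-1))` are split at level `i` by the
hyperplanes `{x | x j = m / 2^i}`, `m` odd, `0 < m < 2^i`; for each axis `j` and each level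
`1 ≤ i ≤ τ`, every one of these hyperplanes receives a copy of the construction in dimension `D - 1`
with parameter `ε_i`. In dimensions `D ≤ k`, which the construction does not use, the value is
`∅`. -/
def quadtreeNet (k : ℕ) : (D : ℕ) → ℝ → Set (AffineSubspace ℝ (EuclideanSpace ℝ (Fin D)))
  | 0, _ => ∅
  | d + 1, ε =>
    if d = k then gridHyperplanes (d + 1) ε
    else
      {F | ∃ (j : Fin (d + 1)) (i m : ℕ),
        1 ≤ i ∧ (i : ℤ) ≤ quadtreeDepth (d + 1) ε ∧ Odd m ∧ m < 2 ^ i ∧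
        ∃ G ∈ quadtreeNet k d (levelEps (d + 1) ε i),
          F = G.map (hyperplaneEmbedding j ((m : ℝ) / 2 ^ i))}

end

/-!
The net property is proved by induction on the dimension `D`, for every `ε > 0` and every compact
convex `K` in the unit cube with `vol K ≥ ε`. Such a `K` has width `w ≥ ε ^ (1 / D)` along some
axis, since it lies in the box of its coordinate projections (`exists_wide_axis`). For `D = k + 1`
the projection to this axis is at least as long as the mesh of the grid, so `K` meets the grid.

For `D ≥ k + 2` it is enough to find a splitting hyperplane of some level `i ≤ τ` in which the slice
of `K` has volume at least `ε_i = 2 ^ i ε / (4 D)` (`exists_heavy_slice`). By Fubini's theorem some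
slice orthogonal to the wide axis, at height `p` say, has volume at least the average `ε / w`.
Joining it to the points of `K` at all other heights shows that the slices at the heights
`(1 - s) p + s y`, with `y` in the projection of `K`, have volume at least
`(1 - s) ^ (D - 1) ε / w` (`volume_slice_ge_of_convex`); no Brunn–Minkowski inequality is needed.
These heights form a segment of length `s w`. Take `s w = 1 / 2 ^ i` with `s D` between `1 / 2` and
`1`. Then the segment contains a dyadic height of level at most `i`, the level `i` is at most `τ`
because `w ≥ ε ^ (1 / D)`, and `(1 - s) ^ (D - 1) ≥ 1 / (4 s D)` is exactly what is needed for the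
slice to have volume at least `ε_i` (`one_le_four_mul_mul_one_sub_div_pow`).

The number of flats is bounded by induction as well, for all `ε > 0` because the parameters `ε_i` may
exceed `1` (`exists_finset_quadtreeNet`): the contributions of the levels grow geometrically, so the
deepest one, where `2 ^ τ = O(ε ^ (-1 / D))`, determines the exponent.
-/

/-! ### Flats in hyperplanes -/

@[simp]
theorem hyperplaneEmbedding_apply_same {d : ℕ} (j : Fin (d + 1)) (c : ℝ)
    (x : EuclideanSpace ℝ (Fin d)) : hyperplaneEmbedding j c x j = c := by
  simp [hyperplaneEmbedding]

@[simp]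
theorem hyperplaneEmbedding_apply_succAbove {d : ℕ} (j : Fin (d + 1)) (c : ℝ)
    (x : EuclideanSpace ℝ (Fin d)) (i : Fin d) :
    hyperplaneEmbedding j c x (j.succAbove i) = x i := by
  simp [hyperplaneEmbedding]

theorem hyperplaneEmbedding_injective {d : ℕ} (j : Fin (d + 1)) (c : ℝ) :
    Function.Injective (hyperplaneEmbedding j c) := by
  intro x y h
  ext i
  simpa using congrArg (fun z : EuclideanSpace ℝ (Fin (d + 1)) => z (j.succAbove i)) h

theorem continuous_hyperplaneEmbedding {d : ℕ} (j : Fin (d + 1)) (c : ℝ) :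
    Continuous (hyperplaneEmbedding j c) :=
  (hyperplaneEmbedding j c).continuous_of_finiteDimensional

/-- Deleting the `j`-th coordinate of `x` and inserting it again gives `x` back. -/
theorem hyperplaneEmbedding_removeNth {d : ℕ} (j : Fin (d + 1))
    (x : EuclideanSpace ℝ (Fin (d + 1))) :
    hyperplaneEmbedding j (x j) (WithLp.toLp 2 fun i => x (j.succAbove i)) = x := by
  ext i
  refine Fin.succAboveCases j ?_ (fun i => ?_) i <;> simp

theorem axisHyperplane_eq_map_top {d : ℕ} (j : Fin (d + 1)) (c : ℝ) :
    axisHyperplane j c = (⊤ : AffineSubspace ℝ (EuclideanSpace ℝ (Fin d))).map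
      (hyperplaneEmbedding j c) := by
  ext x
  rw [AffineSubspace.mem_map]
  constructor
  · intro hx
    have hx : x j = c := hx
    exact ⟨_, AffineSubspace.mem_top ℝ _ _, hx ▸ hyperplaneEmbedding_removeNth j x⟩
  · rintro ⟨y, -, rfl⟩
    exact hyperplaneEmbedding_apply_same j c y

theorem IsFlat.map {d k : ℕ} {F : AffineSubspace ℝ (EuclideanSpace ℝ (Fin d))} (hF : IsFlat k F)
    (j : Fin (d + 1)) (c : ℝ) : IsFlat k (F.map (hyperplaneEmbedding j c)) := by
  obtain ⟨p, hp, rfl⟩ := hF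
  refine ⟨hyperplaneEmbedding j c ∘ p, hp.map' _ (hyperplaneEmbedding_injective j c), ?_⟩
  rw [AffineSubspace.map_span, Set.range_comp]

theorem isFlat_top (d : ℕ) : IsFlat d (⊤ : AffineSubspace ℝ (EuclideanSpace ℝ (Fin d))) := by
  obtain ⟨b⟩ := AffineBasis.exists_affineBasis_of_finiteDimensional (k := ℝ) (ι := Fin (d + 1))
    (P := EuclideanSpace ℝ (Fin d)) (by simp)
  exact ⟨b, b.ind, b.tot.symm⟩

theorem isFlat_axisHyperplane {d : ℕ} (j : Fin (d + 1)) (c : ℝ) :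
    IsFlat d (axisHyperplane j c) := by
  rw [axisHyperplane_eq_map_top]
  exact (isFlat_top d).map j c

theorem isFlat_of_mem_quadtreeNet {k D : ℕ} {ε : ℝ}
    {F : AffineSubspace ℝ (EuclideanSpace ℝ (Fin D))} (hF : F ∈ quadtreeNet k D ε) :
    IsFlat k F := by
  induction D generalizing ε with
  | zero => exact hF.elim
  | succ d ih =>
    rw [quadtreeNet] at hF
    split_ifs at hF with h
    · subst h
      obtain ⟨j, m, -, -, rfl⟩ := hF
      exact isFlat_axisHyperplane j _
    · obtain ⟨j, i, m, -, -, -, -, G, hG, rfl⟩ := hF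
      exact (ih hG).map j _

/-! ### Axis-parallel slices of convex sets -/

theorem isCompact_preimage_hyperplaneEmbedding {d : ℕ} (j : Fin (d + 1)) (c : ℝ)
    {K : Set (EuclideanSpace ℝ (Fin (d + 1)))} (hK : IsCompact K) :
    IsCompact (hyperplaneEmbedding j c ⁻¹' K) := by
  have hcont : Continuous fun x : EuclideanSpace ℝ (Fin (d + 1)) =>
      (WithLp.toLp 2 fun i => x (j.succAbove i) : EuclideanSpace ℝ (Fin d)) := by
    fun_prop
  refine (hK.image hcont).of_isClosed_subset
    (hK.isClosed.preimage (continuous_hyperplaneEmbedding j c)) fun y hy => ⟨_, hy, ?_⟩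
  ext i
  simp

/-- Fubini's theorem for the slices orthogonal to the `j`-th axis. -/
theorem volume_eq_lintegral_slice {d : ℕ} (j : Fin (d + 1))
    {K : Set (EuclideanSpace ℝ (Fin (d + 1)))} (hK : MeasurableSet K) :
    volume K = ∫⁻ t, volume (hyperplaneEmbedding j t ⁻¹' K) := by
  have h1 := (PiLp.volume_preserving_toLp (Fin (d + 1))).comp
    (volume_preserving_piFinSuccAbove (fun _ : Fin (d + 1) => ℝ) j).symm
  rw [← h1.measure_preimage hK.nullMeasurableSet, Measure.volume_eq_prod,
    Measure.prod_apply (h1.measurable hK)]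
  refine lintegral_congr fun t => ?_
  have h2 : MeasurableSet (hyperplaneEmbedding j t ⁻¹' K) :=
    (continuous_hyperplaneEmbedding j t).measurable hK
  rw [← (PiLp.volume_preserving_toLp (Fin d)).measure_preimage h2.nullMeasurableSet]
  rfl

/-- The cone over the slice at height `p` with an apex `q` at height `y` bounds the slices between
`p` and `y` from below. -/
theorem volume_slice_ge_of_convex {d : ℕ} (j : Fin (d + 1))
    {K : Set (EuclideanSpace ℝ (Fin (d + 1)))} (hK : Convex ℝ K)
    {q : EuclideanSpace ℝ (Fin (d + 1))} (hq : q ∈ K) (p : ℝ) {s : ℝ} (hs0 : 0 ≤ s)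
    (hs1 : s ≤ 1) :
    ENNReal.ofReal ((1 - s) ^ d) * volume (hyperplaneEmbedding j p ⁻¹' K) ≤
      volume (hyperplaneEmbedding j ((1 - s) * p + s * q j) ⁻¹' K) := by
  set q' : EuclideanSpace ℝ (Fin d) := WithLp.toLp 2 fun i => q (j.succAbove i) with hq'
  have h := Measure.addHaar_image_homothety (volume : Measure (EuclideanSpace ℝ (Fin d))) q'
    (1 - s) (hyperplaneEmbedding j p ⁻¹' K)
  rw [finrank_euclideanSpace_fin, abs_of_nonneg (pow_nonneg (by linarith) _)] at h
  rw [← h]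
  refine measure_mono ?_
  rintro _ ⟨x, hx, rfl⟩
  have hx : hyperplaneEmbedding j p x ∈ K := hx
  have h2 := hK hx hq (by linarith : 0 ≤ 1 - s) hs0 (by ring)
  rw [Set.mem_preimage]
  convert h2 using 1
  ext i
  refine Fin.succAboveCases j ?_ (fun i => ?_) i
  · simp
  · simp [AffineMap.homothety_apply, hq']
    ring

/-- A set of volume at least `ε` in dimension `D = d + 1` has width at least `ε ^ (1 / D)` along
some axis (the `j`-th one, with `a` and `b` extreme points of the set along it), since it lies in
the product of its coordinate projections. -/
theorem exists_wide_axis {d : ℕ} {K : Set (EuclideanSpace ℝ (Fin (d + 1)))} (hK : IsCompact K)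
    {ε : ℝ} (hε : 0 < ε) (hv : ENNReal.ofReal ε ≤ volume K) :
    ∃ j, ∃ a ∈ K, ∃ b ∈ K, (∀ x ∈ K, a j ≤ x j ∧ x j ≤ b j) ∧
      ε ^ (1 / ((d + 1 : ℕ) : ℝ)) ≤ b j - a j := by
  have hne : K.Nonempty := by
    refine nonempty_of_measure_ne_zero (μ := volume) (ne_of_gt (lt_of_lt_of_le ?_ hv))
    simpa using hε
  have hcont : ∀ j : Fin (d + 1), ContinuousOn
      (fun x : EuclideanSpace ℝ (Fin (d + 1)) => x j) K :=
    fun j => Continuous.continuousOn (by fun_prop)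
  choose a haK ha using fun j => hK.exists_isMinOn hne (hcont j)
  choose b hbK hb using fun j => hK.exists_isMaxOn hne (hcont j)
  by_contra! hcon
  have hcon' : ∀ j, b j j - a j j < ε ^ (1 / ((d + 1 : ℕ) : ℝ)) := fun j =>
    hcon j (a j) (haK j) (b j) (hbK j) fun x hx => ⟨ha j hx, hb j hx⟩
  have hsub : WithLp.toLp 2 ⁻¹' K ⊆ Set.Icc (fun j => a j j) (fun j => b j j) := by
    intro x hx
    exact ⟨fun j => ha j hx, fun j => hb j hx⟩
  have h1 : volume K ≤ ENNReal.ofReal (∏ j, (b j j - a j j)) := by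
    rw [← (PiLp.volume_preserving_toLp (Fin (d + 1))).measure_preimage
      hK.measurableSet.nullMeasurableSet]
    refine (measure_mono hsub).trans ?_
    rw [Real.volume_Icc_pi, ENNReal.ofReal_prod_of_nonneg]
    intro j _
    exact sub_nonneg.2 (ha j (hbK j))
  have h2 : ∏ j, (b j j - a j j) < ε := by
    obtain h0 | h0 := em (∃ j, b j j - a j j ≤ 0)
    · obtain ⟨j, hj⟩ := h0
      rw [Finset.prod_eq_zero (Finset.mem_univ j) (le_antisymm hj (sub_nonneg.2 (ha j (hbK j))))]
      exact hε
    · push Not at h0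
      calc ∏ j, (b j j - a j j) < ∏ _j : Fin (d + 1), ε ^ (1 / ((d + 1 : ℕ) : ℝ)) :=
            Finset.prod_lt_prod_of_nonempty (fun j _ => h0 j) (fun j _ => hcon' j)
              Finset.univ_nonempty
        _ = ε := by
            rw [Finset.prod_const, Finset.card_univ, Fintype.card_fin, one_div]
            exact Real.rpow_inv_natCast_pow hε.le (Nat.succ_ne_zero d)
  have h3 := hv.trans h1
  rw [ENNReal.ofReal_le_ofReal_iff'] at h3
  rcases h3 with h3 | h3 <;> linarith

/-! ### A heavy slice at a dyadic height -/

/-- A segment of length `1 / 2 ^ i` in `[0, 1]` meets a splitting hyperplane of level at most `i`. -/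
theorem exists_odd_div_two_pow_mem {u : ℝ} {i : ℕ} (hi : 1 ≤ i) (hu : 0 ≤ u)
    (hu1 : u + 1 / 2 ^ i ≤ 1) :
    ∃ i' m : ℕ, 1 ≤ i' ∧ i' ≤ i ∧ Odd m ∧ m < 2 ^ i' ∧
      u ≤ (m : ℝ) / 2 ^ i' ∧ (m : ℝ) / 2 ^ i' ≤ u + 1 / 2 ^ i := by
  have hpos : (0 : ℝ) < 2 ^ i := by positivity
  have h2 : (2 : ℝ) ≤ 2 ^ i := by simpa using pow_le_pow_right₀ (one_le_two : (1 : ℝ) ≤ 2) hi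
  have hle : u * 2 ^ i + 1 ≤ 2 ^ i := by
    have := mul_le_mul_of_nonneg_right hu1 hpos.le
    rw [add_mul, one_div, inv_mul_cancel₀ hpos.ne'] at this
    linarith
  have hu0 : 0 ≤ u * 2 ^ i := mul_nonneg hu hpos.le
  -- The multiples of `1 / 2 ^ i` in the segment include one different from `0` and `1`.
  obtain ⟨n, hn0, hn1, hn2, hn3⟩ : ∃ n : ℕ, 0 < n ∧ n < 2 ^ i ∧ u * 2 ^ i ≤ n ∧
      (n : ℝ) ≤ u * 2 ^ i + 1 := by
    rcases hu0.eq_or_lt with h0 | h0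
    · refine ⟨1, one_pos, ?_, ?_, ?_⟩
      · exact_mod_cast (by linarith : (1 : ℝ) < 2 ^ i)
      · rw [← h0]; simp
      · rw [← h0]; simp
    · refine ⟨⌈u * 2 ^ i⌉₊, Nat.ceil_pos.2 h0, ?_, Nat.le_ceil _, (Nat.ceil_lt_add_one hu0).le⟩
      exact_mod_cast (Nat.ceil_lt_add_one hu0).trans_le hle
  obtain ⟨r, m, hm, rfl⟩ := Nat.exists_eq_two_pow_mul_odd hn0.ne'
  have hm0 : 1 ≤ m := hm.pos
  have hri : r < i := by
    by_contra! h
    have := Nat.pow_le_pow_right (n := 2) two_pos h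
    nlinarith
  have hsplit : (2 : ℝ) ^ i = 2 ^ r * 2 ^ (i - r) := by
    rw [← pow_add, Nat.add_sub_cancel' hri.le]
  have hval : (m : ℝ) / 2 ^ (i - r) = ((2 ^ r * m : ℕ) : ℝ) / 2 ^ i := by
    rw [hsplit]
    push_cast
    rw [mul_div_mul_left _ _ (by positivity)]
  refine ⟨i - r, m, by omega, by omega, hm, ?_, ?_, ?_⟩
  · rw [← Nat.add_sub_cancel' hri.le, pow_add] at hn1
    exact lt_of_mul_lt_mul_left hn1 (Nat.zero_le _)
  · rw [hval, le_div_iff₀ hpos]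
    exact hn2
  · rw [hval, div_le_iff₀ hpos, add_mul, one_div, inv_mul_cancel₀ hpos.ne']
    exact hn3

/-- The factor `(1 - c / D) ^ (D - 1)` lost in the cone bound, where `D = d + 1`, is at least
`exp (-c)`, and `exp c ≤ 4 c` on `[1 / 2, 1]`. -/
theorem one_le_four_mul_mul_one_sub_div_pow {d : ℕ} {c : ℝ} (hd : 1 ≤ d) (hc : 1 / 2 ≤ c)
    (hc1 : c ≤ 1) : 1 ≤ 4 * c * (1 - c / ((d + 1 : ℕ) : ℝ)) ^ d := by
  have hd' : (1 : ℝ) ≤ d := by exact_mod_cast hd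
  have hD : (0 : ℝ) < ((d + 1 : ℕ) : ℝ) := by positivity
  push_cast at hD ⊢
  have hDc : (d : ℝ) ≤ d + 1 - c := by linarith
  have hpos : 0 < (d : ℝ) + 1 - c := by linarith
  have h1 : Real.exp (-(c / (d + 1 - c))) ≤ 1 - c / (d + 1) := by
    have h := Real.add_one_le_exp (c / (d + 1 - c))
    have he : 1 - c / ((d : ℝ) + 1) = (c / (d + 1 - c) + 1)⁻¹ := by
      field_simp
      ring
    rw [Real.exp_neg, he]
    exact inv_anti₀ (by positivity) h
  have h2 : Real.exp (-c) ≤ (1 - c / (d + 1)) ^ d := by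
    refine le_trans ?_ (pow_le_pow_left₀ (Real.exp_pos _).le h1 d)
    rw [← Real.exp_nat_mul]
    apply Real.exp_le_exp.2
    have : (d : ℝ) * (c / (d + 1 - c)) ≤ c := by
      rw [← mul_div_assoc, div_le_iff₀ hpos]
      nlinarith
    linarith
  -- `exp c` is at most `√e / (3 / 2 - c)`, where `√e < 1.65`.
  have h3 : Real.exp (1 / 2) ≤ 1.65 := by
    have h := Real.exp_one_lt_d9
    have h' : Real.exp (1 / 2) ^ 2 = Real.exp 1 := by
      rw [← Real.exp_nat_mul]; norm_num
    nlinarith [Real.exp_pos (1 / 2)]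
  have h4 : (3 / 2 - c) / 1.65 ≤ Real.exp (-c) := by
    have h := Real.add_one_le_exp (1 / 2 - c)
    have h' : Real.exp (1 / 2 - c) = Real.exp (1 / 2) * Real.exp (-c) := by
      rw [← Real.exp_add]; ring_nf
    rw [div_le_iff₀ (by norm_num)]
    nlinarith [Real.exp_pos (-c)]
  have h5 := h4.trans h2
  rw [div_le_iff₀ (by norm_num)] at h5
  nlinarith

/-- The level at which the mesh `1 / 2 ^ i` is the width `w` divided by the dimension, up to a factor
of at most two, lies within the depth of the quadtree. -/
theorem exists_level {D : ℕ} (hD : 2 ≤ D) {ε w : ℝ} (hε : 0 < ε) (hw : ε ^ (1 / (D : ℝ)) ≤ w)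
    (hw1 : w ≤ 1) :
    ∃ i : ℕ, 1 ≤ i ∧ (i : ℤ) ≤ quadtreeDepth D ε ∧ (D : ℝ) / w ≤ 2 ^ i ∧
      (2 : ℝ) ^ i ≤ 2 * (D / w) := by
  have hD' : (2 : ℝ) ≤ D := by exact_mod_cast hD
  have hr : 0 < ε ^ (1 / (D : ℝ)) := Real.rpow_pos_of_pos hε _
  have hw0 : 0 < w := hr.trans_le hw
  have hx : 2 ≤ (D : ℝ) / w := by
    rw [le_div_iff₀ hw0]; nlinarith
  have hx0 : 0 < (D : ℝ) / w := by linarith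
  set L := Real.logb 2 ((D : ℝ) / w) with hL
  have hL1 : 1 ≤ L := by
    rw [hL, Real.le_logb_iff_rpow_le one_lt_two hx0]
    simpa using hx
  have hpow : (2 : ℝ) ^ L = D / w := Real.rpow_logb two_pos (by norm_num) hx0
  refine ⟨⌈L⌉₊, Nat.one_le_iff_ne_zero.2 (Nat.ceil_pos.2 (by linarith)).ne', ?_, ?_, ?_⟩
  · have h1 : L ≤ 1 / (D : ℝ) * Real.logb 2 (1 / ε) + Real.logb 2 (3 * (D : ℝ)) := by
      have h2 : L ≤ Real.logb 2 ((1 / ε) ^ (1 / (D : ℝ)) * (3 * D)) := by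
        refine Real.logb_le_logb_of_le one_lt_two hx0 ?_
        have h3 : (D : ℝ) / w ≤ D / ε ^ (1 / (D : ℝ)) :=
          div_le_div_of_nonneg_left (by linarith) hr hw
        rw [Real.div_rpow zero_le_one hε.le, Real.one_rpow]
        refine h3.trans ?_
        rw [div_mul_eq_mul_div, one_mul]
        gcongr
        linarith
      rwa [Real.logb_mul (by positivity) (by positivity), Real.logb_rpow_eq_mul_logb_of_pos
        (by positivity)] at h2
    have h4 : 0 ≤ Real.logb 2 (3 * (D : ℝ)) := Real.logb_nonneg one_lt_two (by linarith)
    have h5 : (0 : ℤ) ≤ ⌈Real.logb 2 (3 * (D : ℝ))⌉ := Int.ceil_nonneg h4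
    have h6 : (⌈L⌉₊ : ℤ) = ⌈L⌉ := by
      rw [Int.natCast_ceil_eq_ceil (by linarith)]
    have h7 : ⌈L⌉ ≤ ⌈1 / (D : ℝ) * Real.logb 2 (1 / ε)⌉ + ⌈Real.logb 2 (3 * (D : ℝ))⌉ :=
      (Int.ceil_le_ceil h1).trans (Int.ceil_add_le _ _)
    rw [h6, quadtreeDepth]
    omega
  · rw [← hpow, ← Real.rpow_natCast]
    exact Real.rpow_le_rpow_of_exponent_le one_le_two (Nat.le_ceil L)
  · rw [← hpow, ← Real.rpow_natCast, ← Real.rpow_one_add' (by norm_num) (by linarith)]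
    refine Real.rpow_le_rpow_of_exponent_le one_le_two ?_
    have := Nat.ceil_lt_add_one (a := L) (by linarith)
    linarith

theorem levelEps_le_levelEps {D : ℕ} {ε : ℝ} (hε : 0 < ε) {i' i : ℕ} (h : i' ≤ i) :
    levelEps D ε i' ≤ levelEps D ε i := by
  unfold levelEps
  gcongr
  norm_num

theorem levelEps_pos {D : ℕ} (hD : 0 < D) {ε : ℝ} (hε : 0 < ε) (i : ℕ) : 0 < levelEps D ε i := by
  unfold levelEps
  positivity

/-- Some slice attains the average `ε / w` over the `j`-th projection `[a, b]`, of length `w`. -/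
theorem exists_slice_ge_average {d : ℕ} (j : Fin (d + 1))
    {K : Set (EuclideanSpace ℝ (Fin (d + 1)))} (hK : MeasurableSet K) {ε a b : ℝ} (hab : a < b)
    (hv : ENNReal.ofReal ε ≤ volume K) (hfin : volume K ≠ ⊤)
    (hx : ∀ x ∈ K, a ≤ x j ∧ x j ≤ b) :
    ∃ p ∈ Set.Icc a b, ENNReal.ofReal (ε / (b - a)) ≤ volume (hyperplaneEmbedding j p ⁻¹' K) := by
  have hba : 0 < b - a := sub_pos.2 hab
  have hint : ∫⁻ t in Set.Icc a b, volume (hyperplaneEmbedding j t ⁻¹' K) = volume K := by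
    rw [volume_eq_lintegral_slice j hK]
    refine setLIntegral_eq_of_support_subset ?_
    intro t ht
    obtain ⟨y, hy⟩ := nonempty_of_measure_ne_zero ht
    simpa using hx _ hy
  obtain ⟨p, hp, h⟩ := exists_setLAverage_le (μ := volume) (s := Set.Icc a b)
    (f := fun t => volume (hyperplaneEmbedding j t ⁻¹' K)) (by simpa using hab)
    measurableSet_Icc.nullMeasurableSet (by rwa [hint])
  refine ⟨p, hp, le_trans ?_ h⟩
  rw [setLAverage_eq, hint, Real.volume_Icc, ENNReal.ofReal_div_of_pos hba]
  gcongr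

/-- A convex set of volume at least `ε` in the cube has a slice in a splitting hyperplane of some
level `i` of volume at least `ε_i`. -/
theorem exists_heavy_slice {d : ℕ} (hd : 1 ≤ d) {K : Set (EuclideanSpace ℝ (Fin (d + 1)))}
    (hK : IsCompact K) (hconv : Convex ℝ K) (hcube : K ⊆ unitCube (d + 1)) {ε : ℝ} (hε : 0 < ε)
    (hv : ENNReal.ofReal ε ≤ volume K) :
    ∃ (j : Fin (d + 1)) (i m : ℕ), 1 ≤ i ∧ (i : ℤ) ≤ quadtreeDepth (d + 1) ε ∧ Odd m ∧
      m < 2 ^ i ∧ ENNReal.ofReal (levelEps (d + 1) ε i) ≤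
        volume (hyperplaneEmbedding j ((m : ℝ) / 2 ^ i) ⁻¹' K) := by
  obtain ⟨j, a, haK, b, hbK, hx, hw⟩ := exists_wide_axis hK hε hv
  have ha0 : 0 ≤ a j := (hcube haK j).1
  have hb1 : b j ≤ 1 := (hcube hbK j).2
  set w := b j - a j with hwdef
  have hw0 : 0 < w := (Real.rpow_pos_of_pos hε _).trans_le hw
  obtain ⟨p, hp, hpv⟩ := exists_slice_ge_average j hK.measurableSet (sub_pos.1 hw0) hv
    hK.measure_lt_top.ne hx
  obtain ⟨i, hi1, hiτ, hi2, hi3⟩ := exists_level (by omega : 2 ≤ d + 1) hε hw (by linarith)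
  have hD : (0 : ℝ) < ((d + 1 : ℕ) : ℝ) := by positivity
  have h2i : (0 : ℝ) < 2 ^ i := by positivity
  -- The mesh is `s * w`, and `c = s * D` lies between `1 / 2` and `1`.
  set c : ℝ := ((d + 1 : ℕ) : ℝ) / (w * 2 ^ i) with hc
  have hwi : 0 < w * 2 ^ i := by positivity
  have hc1 : c ≤ 1 := by
    rw [hc, div_le_one hwi]
    rwa [div_le_iff₀ hw0, mul_comm] at hi2
  have hc2 : 1 / 2 ≤ c := by
    rw [hc, le_div_iff₀ hwi]
    have : w * 2 ^ i ≤ w * (2 * (((d + 1 : ℕ) : ℝ) / w)) := by gcongr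
    have h' : w * (2 * (((d + 1 : ℕ) : ℝ) / w)) = 2 * ((d + 1 : ℕ) : ℝ) := by field_simp
    linarith
  set s : ℝ := c / ((d + 1 : ℕ) : ℝ) with hs
  have hs0 : 0 < s := by positivity
  have hs1 : s ≤ 1 := by
    rw [hs, div_le_one hD]
    refine hc1.trans ?_
    exact_mod_cast Nat.succ_le_succ (Nat.zero_le d)
  have hsw : s * w = 1 / 2 ^ i := by
    rw [hs, hc]; field_simp
  -- The cone over the slice at `p` covers the segment of length `s * w` obtained by shrinking
  -- the projection `[a, b]` towards `p`.
  have hseg : (1 - s) * p + s * a j + 1 / 2 ^ i = (1 - s) * p + s * b j := by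
    rw [← hsw, hwdef]; ring
  obtain ⟨i', m, hi'1, hi'i, hm, hmlt, hum, hmu⟩ := exists_odd_div_two_pow_mem
    (u := (1 - s) * p + s * a j) hi1 (by nlinarith [hp.1]) (by rw [hseg]; nlinarith [hp.2])
  rw [hseg] at hmu
  refine ⟨j, i', m, hi'1, le_trans (by exact_mod_cast hi'i) hiτ, hm, hmlt, ?_⟩
  obtain ⟨q, hqK, hq⟩ : ∃ q ∈ K, (m : ℝ) / 2 ^ i' = (1 - s) * p + s * q j := by
    set z := ((m : ℝ) / 2 ^ i' - (1 - s) * p) / s with hz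
    have hsz : s * z = (m : ℝ) / 2 ^ i' - (1 - s) * p := by rw [hz]; field_simp
    have hza : a j ≤ z := by
      rw [hz, le_div_iff₀ hs0]; linarith
    have hzb : z ≤ b j := by
      rw [hz, div_le_iff₀ hs0]; linarith
    obtain ⟨q, hqK, hqz⟩ := hconv.isPreconnected.intermediate_value haK hbK
      (f := fun x : EuclideanSpace ℝ (Fin (d + 1)) => x j)
      (Continuous.continuousOn (by fun_prop)) ⟨hza, hzb⟩
    refine ⟨q, hqK, ?_⟩
    have hqz : q j = z := hqz
    rw [hqz, hsz]; ring
  rw [hq]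
  refine le_trans ?_ (volume_slice_ge_of_convex j hconv hqK p hs0.le hs1)
  refine le_trans ?_ (mul_le_mul_right hpv _)
  have h1s : 0 ≤ (1 - s) ^ d := pow_nonneg (by linarith) _
  rw [← ENNReal.ofReal_mul h1s]
  refine ENNReal.ofReal_le_ofReal ((levelEps_le_levelEps hε hi'i).trans ?_)
  have hkey := one_le_four_mul_mul_one_sub_div_pow hd hc2 hc1
  rw [← hs] at hkey
  have hlev : levelEps (d + 1) ε i = ε / w * (1 / (4 * c)) := by
    rw [levelEps, hc]; field_simp
  rw [hlev, mul_comm]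
  refine mul_le_mul_of_nonneg_right ?_ (by positivity)
  rw [div_le_iff₀ (by positivity)]
  linarith

/-! ### The net property -/

/-- A set of volume at least `ε` in the cube has a projection of length at least the mesh of the
grid, so it meets one of the hyperplanes. -/
theorem exists_gridHyperplanes_inter_nonempty {d : ℕ} {K : Set (EuclideanSpace ℝ (Fin (d + 1)))}
    (hK : IsCompact K) (hconv : Convex ℝ K) (hcube : K ⊆ unitCube (d + 1)) {ε : ℝ} (hε : 0 < ε)
    (hv : ENNReal.ofReal ε ≤ volume K) :
    ∃ F ∈ gridHyperplanes (d + 1) ε,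
      ((F : Set (EuclideanSpace ℝ (Fin (d + 1)))) ∩ K).Nonempty := by
  obtain ⟨j, a, haK, b, hbK, -, hw⟩ := exists_wide_axis hK hε hv
  have ha0 : 0 ≤ a j := (hcube haK j).1
  have hb1 : b j ≤ 1 := (hcube hbK j).2
  have hs0 : 0 < ε ^ (1 / ((d + 1 : ℕ) : ℝ)) := Real.rpow_pos_of_pos hε _
  set s := ε ^ (1 / ((d + 1 : ℕ) : ℝ)) with hs
  set m := ⌊b j / s⌋₊ with hm
  have hbs : 0 ≤ b j / s := div_nonneg (by linarith) hs0.le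
  have h1 : (m : ℝ) * s ≤ b j := (le_div_iff₀ hs0).1 (Nat.floor_le hbs)
  have h2 : a j ≤ m * s := by
    have := (div_lt_iff₀ hs0).1 (Nat.lt_floor_add_one (b j / s))
    rw [← hm] at this
    linarith
  obtain ⟨x, hxK, hx⟩ := hconv.isPreconnected.intermediate_value haK hbK
    (f := fun x : EuclideanSpace ℝ (Fin (d + 1)) => x j)
    (Continuous.continuousOn (by fun_prop)) ⟨h2, h1⟩
  refine ⟨_, ⟨j, m, ?_, h1.trans hb1, rfl⟩, x, hx, hxK⟩
  rw [hm, Nat.one_le_floor_iff, one_le_div hs0]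
  linarith

theorem exists_quadtreeNet_inter_nonempty {k D : ℕ} (hk : 1 ≤ k) (hkD : k < D)
    {K : Set (EuclideanSpace ℝ (Fin D))} (hK : IsCompact K) (hconv : Convex ℝ K)
    (hcube : K ⊆ unitCube D) {ε : ℝ} (hε : 0 < ε) (hv : ENNReal.ofReal ε ≤ volume K) :
    ∃ F ∈ quadtreeNet k D ε, ((F : Set (EuclideanSpace ℝ (Fin D))) ∩ K).Nonempty := by
  induction D generalizing ε with
  | zero => omega
  | succ d ih =>
    rw [quadtreeNet]
    split_ifs with h
    · exact exists_gridHyperplanes_inter_nonempty hK hconv hcube hε hv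
    · obtain ⟨j, i, m, hi1, hiτ, hm, hmlt, hsl⟩ :=
        exists_heavy_slice (by omega) hK hconv hcube hε hv
      obtain ⟨G, hG, y, hyG, hyK⟩ := ih (by omega)
        (K := hyperplaneEmbedding j ((m : ℝ) / 2 ^ i) ⁻¹' K)
        (isCompact_preimage_hyperplaneEmbedding j _ hK)
        (hconv.affine_preimage _)
        (fun y hy l => by simpa using hcube hy (j.succAbove l))
        (levelEps_pos (Nat.succ_pos d) hε i) hsl
      exact ⟨_, ⟨j, i, m, hi1, hiτ, hm, hmlt, G, hG, rfl⟩, _,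
        AffineSubspace.mem_map_of_mem _ hyG, hyK⟩

/-! ### The number of flats -/

theorem exists_finset_gridHyperplanes {d : ℕ} {ε : ℝ} (hε : 0 < ε) :
    ∃ s : Finset (AffineSubspace ℝ (EuclideanSpace ℝ (Fin (d + 1)))),
      gridHyperplanes (d + 1) ε ⊆ s ∧
        (s.card : ℝ) ≤ ((d + 1 : ℕ) : ℝ) * ε ^ (-(1 / ((d + 1 : ℕ) : ℝ))) := by
  classical
  set r := ε ^ (1 / ((d + 1 : ℕ) : ℝ)) with hr
  have hr0 : 0 < r := Real.rpow_pos_of_pos hε _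
  refine ⟨Finset.univ.biUnion fun j : Fin (d + 1) =>
    (Finset.Icc 1 ⌊1 / r⌋₊).image fun m : ℕ => axisHyperplane j ((m : ℝ) * r), ?_, ?_⟩
  · rintro F ⟨j, m, hm1, hm, rfl⟩
    simp only [Finset.coe_biUnion, Set.mem_iUnion, Finset.coe_image]
    refine ⟨j, Finset.mem_univ j, m, ?_, rfl⟩
    rw [Finset.mem_coe, Finset.mem_Icc]
    exact ⟨hm1, Nat.le_floor ((le_div_iff₀ hr0).2 hm)⟩
  · have h := Finset.card_biUnion_le_card_mul (Finset.univ : Finset (Fin (d + 1)))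
      (fun j => (Finset.Icc 1 ⌊1 / r⌋₊).image fun m : ℕ => axisHyperplane j ((m : ℝ) * r))
      ⌊1 / r⌋₊ fun j _ => Finset.card_image_le.trans (by simp)
    rw [Finset.card_univ, Fintype.card_fin] at h
    have h' : (⌊1 / r⌋₊ : ℝ) ≤ 1 / r := Nat.floor_le (by positivity)
    rw [Real.rpow_neg hε.le, ← hr, ← one_div]
    refine le_trans (Nat.cast_le.2 h) ?_
    push_cast
    gcongr

/-- The depth `τ` satisfies `2 ^ τ = O(ε ^ (-1 / D))`. -/
theorem exists_two_pow_quadtreeDepth_le (D : ℕ) :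
    ∃ B : ℝ, 0 < B ∧ ∀ ε : ℝ, 0 < ε → ∀ n : ℕ, (n : ℤ) ≤ quadtreeDepth D ε →
      (2 : ℝ) ^ n ≤ B * ε ^ (-(1 / (D : ℝ))) := by
  refine ⟨2 ^ ((3 * ⌈Real.logb 2 (3 * (D : ℝ))⌉ + 2 : ℤ) : ℝ), by positivity, ?_⟩
  intro ε hε n hn
  have h1 : ε ^ (-(1 / (D : ℝ))) = 2 ^ (1 / (D : ℝ) * Real.logb 2 (1 / ε)) := by
    rw [mul_comm, Real.rpow_mul two_pos.le, Real.rpow_logb two_pos (by norm_num) (by positivity),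
      one_div ε, Real.inv_rpow hε.le, Real.rpow_neg hε.le]
  rw [h1, ← Real.rpow_add two_pos, ← Real.rpow_natCast]
  refine Real.rpow_le_rpow_of_exponent_le one_le_two ?_
  have h2 : (n : ℝ) ≤ (quadtreeDepth D ε : ℝ) := by exact_mod_cast hn
  have h3 := (Int.ceil_lt_add_one (1 / (D : ℝ) * Real.logb 2 (1 / ε))).le
  rw [quadtreeDepth] at h2
  push_cast at h2 ⊢
  linarith

/-- The number of flats placed by the recursion. -/
theorem exists_finset_quadtreeNet_succ {k d : ℕ} (hkd : d ≠ k) {ε : ℝ} {b : ℕ → ℝ}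
    (h : ∀ i, ∃ s : Finset (AffineSubspace ℝ (EuclideanSpace ℝ (Fin d))),
      quadtreeNet k d (levelEps (d + 1) ε i) ⊆ s ∧ (s.card : ℝ) ≤ b i) :
    ∃ s : Finset (AffineSubspace ℝ (EuclideanSpace ℝ (Fin (d + 1)))),
      quadtreeNet k (d + 1) ε ⊆ s ∧
        (s.card : ℝ) ≤ ((d + 1 : ℕ) : ℝ) *
          ∑ i ∈ Finset.Icc 1 (quadtreeDepth (d + 1) ε).toNat, 2 ^ i * b i := by
  classical
  choose t ht htb using h
  refine ⟨Finset.univ.biUnion fun j : Fin (d + 1) =>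
    (Finset.Icc 1 (quadtreeDepth (d + 1) ε).toNat).biUnion fun i =>
      (Finset.range (2 ^ i)).biUnion fun m =>
        (t i).image fun G => G.map (hyperplaneEmbedding j ((m : ℝ) / 2 ^ i)), ?_, ?_⟩
  · rw [quadtreeNet, if_neg hkd]
    rintro F ⟨j, i, m, hi1, hiτ, -, hm, G, hG, rfl⟩
    rw [Finset.mem_coe, Finset.mem_biUnion]
    refine ⟨j, Finset.mem_univ j, Finset.mem_biUnion.2 ⟨i, Finset.mem_Icc.2 ⟨hi1, ?_⟩,
      Finset.mem_biUnion.2 ⟨m, Finset.mem_range.2 hm, Finset.mem_image_of_mem _ (ht i hG)⟩⟩⟩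
    omega
  · have h := Finset.card_biUnion_le_card_mul (Finset.univ : Finset (Fin (d + 1)))
      (fun j => (Finset.Icc 1 (quadtreeDepth (d + 1) ε).toNat).biUnion fun i =>
        (Finset.range (2 ^ i)).biUnion fun m =>
          (t i).image fun G => G.map (hyperplaneEmbedding j ((m : ℝ) / 2 ^ i)))
      (∑ i ∈ Finset.Icc 1 (quadtreeDepth (d + 1) ε).toNat, 2 ^ i * (t i).card)
      fun j _ => Finset.card_biUnion_le.trans <| Finset.sum_le_sum fun i _ => by
        simpa using Finset.card_biUnion_le_card_mul (Finset.range (2 ^ i)) (fun m : ℕ =>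
          (t i).image fun G => G.map (hyperplaneEmbedding j ((m : ℝ) / 2 ^ i))) (t i).card
          fun m _ => Finset.card_image_le
    rw [Finset.card_univ, Fintype.card_fin] at h
    refine le_trans (Nat.cast_le.2 h) ?_
    push_cast
    gcongr with i _
    exact htb i

theorem sum_Icc_pow_le {r : ℝ} (hr : 1 < r) (n : ℕ) :
    ∑ i ∈ Finset.Icc 1 n, r ^ i ≤ r / (r - 1) * r ^ n := by
  have hr0 : 0 < r - 1 := by linarith
  induction n with
  | zero => simp; positivity
  | succ n ih =>
    rw [Finset.sum_Icc_succ_top (by omega)]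
    have : r / (r - 1) * r ^ (n + 1) = r / (r - 1) * r ^ n + r ^ (n + 1) := by
      rw [pow_succ]; field_simp; ring
    linarith

/-- `|K_D(ε)| = O(ε ^ (-(1 - k / D)))` for all `ε > 0`. In the recursion the flats on level `i`
number `O(2 ^ (i k / (D - 1)) ε ^ (-(1 - k / (D - 1))))`, a geometric sum dominated by the deepest
level, where `2 ^ i = O(ε ^ (-1 / D))`. -/
theorem exists_finset_quadtreeNet {k D : ℕ} (hk : 1 ≤ k) (hkD : k < D) :
    ∃ C : ℝ, 0 < C ∧ ∀ ε : ℝ, 0 < ε →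
      ∃ s : Finset (AffineSubspace ℝ (EuclideanSpace ℝ (Fin D))),
        quadtreeNet k D ε ⊆ s ∧ (s.card : ℝ) ≤ C * ε ^ (-(1 - (k : ℝ) / D)) := by
  induction D with
  | zero => omega
  | succ d ih =>
    by_cases hdk : d = k
    · subst hdk
      refine ⟨((d + 1 : ℕ) : ℝ), by positivity, fun ε hε => ?_⟩
      have he : -(1 - (d : ℝ) / ((d + 1 : ℕ) : ℝ)) = -(1 / ((d + 1 : ℕ) : ℝ)) := by
        push_cast; field_simp; ring
      rw [quadtreeNet, if_pos rfl, he]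
      exact exists_finset_gridHyperplanes hε
    · obtain ⟨C, hC, hnet⟩ := ih (by omega)
      obtain ⟨B, hB, hdepth⟩ := exists_two_pow_quadtreeDepth_le (d + 1)
      have hk0 : (0 : ℝ) < k := by exact_mod_cast hk
      have hd0 : (0 : ℝ) < d := by exact_mod_cast (by omega : 0 < d)
      set θ : ℝ := (k : ℝ) / d with hθ
      have hθ0 : 0 < θ := by positivity
      set r : ℝ := 2 ^ θ with hr
      have hr1 : 1 < r := Real.one_lt_rpow one_lt_two hθ0
      set A : ℝ := 4 * ((d + 1 : ℕ) : ℝ) with hA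
      have hA0 : 0 < A := by positivity
      have hr' : 0 < r - 1 := by linarith
      refine ⟨((d + 1 : ℕ) : ℝ) * (C * A ^ (1 - θ) * (r / (r - 1) * B ^ θ)), by positivity,
        fun ε hε => ?_⟩
      obtain ⟨s, hs, hcard⟩ := exists_finset_quadtreeNet_succ hdk
        (fun i => hnet _ (levelEps_pos (Nat.succ_pos d) hε i))
      refine ⟨s, hs, hcard.trans ?_⟩
      rw [mul_assoc ((d + 1 : ℕ) : ℝ)]
      refine mul_le_mul_of_nonneg_left ?_ (by positivity)
      have hterm : ∀ i : ℕ, (2 : ℝ) ^ i * (C * levelEps (d + 1) ε i ^ (-(1 - θ))) =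
          C * A ^ (1 - θ) * ε ^ (-(1 - θ)) * r ^ i := by
        intro i
        have h2i : (0 : ℝ) < 2 ^ i := by positivity
        have h1 : r ^ i = ((2 : ℝ) ^ i) ^ θ := by
          rw [hr, ← Real.rpow_natCast, ← Real.rpow_mul two_pos.le, mul_comm,
            Real.rpow_mul two_pos.le, Real.rpow_natCast]
        have h2 : ((2 : ℝ) ^ i) ^ θ = 2 ^ i * ((2 : ℝ) ^ i) ^ (-(1 - θ)) := by
          rw [← Real.rpow_one_add' h2i.le (by linarith)]
          ring_nf
        rw [levelEps, ← hA, Real.div_rpow (by positivity) hA0.le,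
          Real.mul_rpow h2i.le hε.le, h1, h2, Real.rpow_neg hA0.le, div_inv_eq_mul]
        ring
      rw [Finset.sum_congr rfl fun i _ => hterm i, ← Finset.mul_sum]
      have hexp : ε ^ (-(1 - (k : ℝ) / ((d + 1 : ℕ) : ℝ))) =
          ε ^ (-(1 - θ)) * (ε ^ (-(1 / ((d + 1 : ℕ) : ℝ)))) ^ θ := by
        rw [← Real.rpow_mul hε.le, ← Real.rpow_add hε]
        congr 1
        rw [hθ]; push_cast; field_simp; ring
      have hE : 0 < ε ^ (-(1 - θ)) := Real.rpow_pos_of_pos hε _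
      have hE' : 0 < ε ^ (-(1 / ((d + 1 : ℕ) : ℝ))) := Real.rpow_pos_of_pos hε _
      have hsum : ∑ i ∈ Finset.Icc 1 (quadtreeDepth (d + 1) ε).toNat, r ^ i ≤
          r / (r - 1) * (B ^ θ * (ε ^ (-(1 / ((d + 1 : ℕ) : ℝ)))) ^ θ) := by
        -- A negative depth, possible for large `ε`, leaves an empty sum.
        rcases lt_or_ge (quadtreeDepth (d + 1) ε) 0 with hneg | hpos
        · rw [Int.toNat_of_nonpos hneg.le]
          simp only [Finset.Icc_eq_empty_of_lt zero_lt_one, Finset.sum_empty]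
          positivity
        · refine (sum_Icc_pow_le hr1 _).trans (mul_le_mul_of_nonneg_left ?_ (by positivity))
          rw [← Real.mul_rpow hB.le hE'.le, hr, ← Real.rpow_natCast, ← Real.rpow_mul two_pos.le,
            mul_comm, Real.rpow_mul two_pos.le, Real.rpow_natCast]
          exact Real.rpow_le_rpow (by positivity)
            (hdepth ε hε _ (Int.toNat_of_nonneg hpos).le) hθ0.le
      rw [hexp]
      calc C * A ^ (1 - θ) * ε ^ (-(1 - θ)) *
            ∑ i ∈ Finset.Icc 1 (quadtreeDepth (d + 1) ε).toNat, r ^ i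
          ≤ C * A ^ (1 - θ) * ε ^ (-(1 - θ)) *
            (r / (r - 1) * (B ^ θ * (ε ^ (-(1 / ((d + 1 : ℕ) : ℝ)))) ^ θ)) :=
            mul_le_mul_of_nonneg_left hsum (by positivity)
        _ = _ := by ring

/-! ### The theorem on quadtree nets -/

theorem isCompact_unitCube (d : ℕ) : IsCompact (unitCube d) := by
  have h : IsCompact (Set.univ.pi fun _ : Fin d => Set.Icc (0 : ℝ) 1) :=
    isCompact_univ_pi fun _ => isCompact_Icc
  convert h.image (PiLp.continuous_toLp 2 fun _ : Fin d => ℝ)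
  ext x
  refine ⟨fun hx => ⟨fun j => x j, fun j _ => hx j, rfl⟩, ?_⟩
  rintro ⟨y, hy, rfl⟩ j
  exact hy j (Set.mem_univ j)

theorem convex_unitCube (d : ℕ) : Convex ℝ (unitCube d) := by
  intro x hx y hy a b ha hb hab j
  exact convex_Icc (0 : ℝ) 1 (hx j) (hy j) ha hb hab

theorem mainTheorem1 (d : ℕ) :
    ∃ C : ℝ, 0 < C ∧
      ∀ k : ℕ, 1 ≤ k → k < d →
        ∀ ε : ℝ, 0 < ε → ε < 1 →
          IsKEpsNet k ε (quadtreeNet k d ε) ∧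
          (quadtreeNet k d ε).Finite ∧
          ((quadtreeNet k d ε).ncard : ℝ) ≤ C * (1 / ε ^ (1 - (k : ℝ) / (d : ℝ))) := by
  have hbound : ∀ k : ℕ, ∃ C : ℝ, 0 < C ∧ (1 ≤ k → k < d → ∀ ε : ℝ, 0 < ε →
      ∃ s : Finset (AffineSubspace ℝ (EuclideanSpace ℝ (Fin d))),
        quadtreeNet k d ε ⊆ s ∧ (s.card : ℝ) ≤ C * ε ^ (-(1 - (k : ℝ) / d))) := by
    intro k
    by_cases h : 1 ≤ k ∧ k < d
    · obtain ⟨C, hC, hC'⟩ := exists_finset_quadtreeNet h.1 h.2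
      exact ⟨C, hC, fun _ _ => hC'⟩
    · exact ⟨1, one_pos, fun h1 h2 => (h ⟨h1, h2⟩).elim⟩
  choose C hC0 hC using hbound
  -- Summing over the finitely many `k < d` makes the constant independent of `k`; the summand `1`
  -- keeps it positive when `d = 0`.
  refine ⟨1 + ∑ k ∈ Finset.range d, C k,
    add_pos_of_pos_of_nonneg one_pos (Finset.sum_nonneg fun k _ => (hC0 k).le), ?_⟩
  intro k hk hkd ε hε _
  obtain ⟨s, hs, hcard⟩ := hC k hk hkd ε hε
  refine ⟨⟨fun F hF => isFlat_of_mem_quadtreeNet hF, fun K hv => ?_⟩,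
    s.finite_toSet.subset hs, ?_⟩
  · obtain ⟨F, hF, x, hxF, hxK⟩ := exists_quadtreeNet_inter_nonempty hk hkd
      (K.isCompact.inter (isCompact_unitCube d)) (K.convex.inter (convex_unitCube d))
      Set.inter_subset_right hε hv
    exact ⟨F, hF, x, hxF, hxK.1⟩
  · have h1 : (quadtreeNet k d ε).ncard ≤ s.card := by
      simpa using Set.ncard_le_ncard hs s.finite_toSet
    have h2 : C k ≤ 1 + ∑ k ∈ Finset.range d, C k := by
      have := Finset.single_le_sum (fun i _ => (hC0 i).le) (Finset.mem_range.2 hkd)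
      linarith
    rw [one_div, ← Real.rpow_neg hε.le]
    calc ((quadtreeNet k d ε).ncard : ℝ) ≤ s.card := by exact_mod_cast h1
      _ ≤ C k * ε ^ (-(1 - (k : ℝ) / d)) := hcard
      _ ≤ _ := mul_le_mul_of_nonneg_right h2 (Real.rpow_nonneg hε.le _)
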